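/- All Hilbert spaces are finite-dimensional and nonzero. A channel is a completely positive, trace preserving linear map between (full) complex matrix algebras. A channel $\Phi$ is called entanglement breaking if it has the form $\Phi(\rho)=\sum_{k=1}^K R_k\,\mathrm{Tr}(X_k\rho)$, where each $R_k$ is a density matrix (positive semidefinite with trace one) and $\{X_k\}$ is a POVM, i.e. $X_k\ge 0$ and $\sum_k X_k=I$. Let $S(\rho)=-\mathrm{Tr}\,\rho\log\rho$ denote the von Neumann entropy, and define the Holevo capacity of a channel $\Omega$ by $$\chi^*(\Omega)=\sup_{\{p_k,\rho_k\}}\Big[S\Big(\Omega\Big(\sum_k p_k\rho_k\Big)\Big)-\sum_k p_k\,S(\Omega(\rho_k))\Big],$$ where the supremum runs over all finite ensembles of input states: density matrices $\rho_k$ with probabilities $p_k\ge 0$, $\sum_k p_k=1$. Theorem. If $\Phi$ is an entanglement breaking channel and $\Omega$ is an arbitrary channel, then the Holevo capacity is additive: $$\chi^*(\Phi\otimes\Omega)=\chi^*(\Phi)+\chi^*(\Omega).$$ -/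

import Mathlib

open scoped Matrix Kronecker ComplexOrder

noncomputable section

namespace Quantum

/-- A density matrix: positive semidefinite of trace one. -/
structure IsDensityMatrix {n : Type*} [Fintype n] (ρ : Matrix n n ℂ) : Prop where
  posSemidef : ρ.PosSemidef
  trace_eq_one : ρ.trace = 1

/-- The von Neumann entropy `S(ρ) = -Tr ρ log ρ = -∑ λᵢ log λᵢ` (natural logarithm, `0 log 0 = 0`),
the sum being over the eigenvalues of the Hermitian matrix `ρ`. It is only used for density
matrices; the value `0` for non-Hermitian matrices is a convention. -/
def vonNeumannEntropy {n : Type*} [Fintype n] [DecidableEq n] (ρ : Matrix n n ℂ) : ℝ :=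
  open Classical in
  if h : ρ.IsHermitian then ∑ i, Real.negMulLog (h.eigenvalues i) else 0

/-- The amplification `id ⊗ Φ` of a linear map `Φ` on matrices: `Φ` is applied to every block of a
block matrix whose blocks are indexed by `ι`. -/
def amplification (ι : Type*) {m n : Type*} (Φ : Matrix m m ℂ →ₗ[ℂ] Matrix n n ℂ)
    (M : Matrix (ι × m) (ι × m) ℂ) : Matrix (ι × n) (ι × n) ℂ :=
  Matrix.of fun p q => Φ (Matrix.of fun x y => M (p.1, x) (q.1, y)) p.2 q.2

/-- A quantum channel: a completely positive, trace preserving linear map. -/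
structure IsChannel {m n : Type*} [Fintype m] [Fintype n]
    (Φ : Matrix m m ℂ →ₗ[ℂ] Matrix n n ℂ) : Prop where
  completelyPositive : ∀ (k : ℕ) (M : Matrix (Fin k × m) (Fin k × m) ℂ),
    M.PosSemidef → (amplification (Fin k) Φ M).PosSemidef
  trace_map : ∀ A : Matrix m m ℂ, (Φ A).trace = A.trace

/-- An entanglement breaking channel: a map `Φ(ρ) = ∑ₖ Rₖ Tr(Xₖ ρ)` where every `Rₖ` is a density
matrix and `{Xₖ}` is a POVM, i.e. `Xₖ ≥ 0` and `∑ₖ Xₖ = I`. -/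
def IsEntanglementBreaking {m n : Type*} [Fintype m] [DecidableEq m] [Fintype n]
    (Φ : Matrix m m ℂ →ₗ[ℂ] Matrix n n ℂ) : Prop :=
  ∃ (K : ℕ) (R : Fin K → Matrix n n ℂ) (X : Fin K → Matrix m m ℂ),
    (∀ k, IsDensityMatrix (R k)) ∧ (∀ k, (X k).PosSemidef) ∧ ∑ k, X k = 1 ∧
    ∀ ρ : Matrix m m ℂ, Φ ρ = ∑ k, (X k * ρ).trace • R k

/-- The tensor product `Φ ⊗ Ω` of two linear maps on matrices: `Ω` acts on the second tensor factor
and `Φ` on the first one. It is the linear map with `(Φ ⊗ Ω)(A ⊗ B) = Φ(A) ⊗ Ω(B)`,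
see `tensorMap_kronecker` and `tensorMap_unique`. -/
def tensorMap {m n m' n' : Type*} (Φ : Matrix m m ℂ →ₗ[ℂ] Matrix n n ℂ)
    (Ω : Matrix m' m' ℂ →ₗ[ℂ] Matrix n' n' ℂ) :
    Matrix (m × m') (m × m') ℂ →ₗ[ℂ] Matrix (n × n') (n × n') ℂ where
  toFun A := Matrix.of fun p q =>
    Φ (Matrix.of fun i j => Ω (Matrix.of fun k l => A (i, k) (j, l)) p.2 q.2) p.1 q.1
  map_add' A B := by
    ext p q
    change Φ (Matrix.of fun i j => Ω ((Matrix.of fun k l => A (i, k) (j, l)) +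
      Matrix.of fun k l => B (i, k) (j, l)) p.2 q.2) p.1 q.1 = _
    simp only [map_add, Matrix.add_apply]
    exact congrFun (congrFun (Φ.map_add (Matrix.of fun i j => Ω _ p.2 q.2)
      (Matrix.of fun i j => Ω _ p.2 q.2)) p.1) q.1
  map_smul' c A := by
    ext p q
    change Φ (Matrix.of fun i j =>
      Ω (c • (Matrix.of fun k l => A (i, k) (j, l))) p.2 q.2) p.1 q.1 = _
    simp only [map_smul, Matrix.smul_apply]
    exact congrFun (congrFun (Φ.map_smul c (Matrix.of fun i j => Ω _ p.2 q.2)) p.1) q.1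

/-- The set of Holevo quantities `S(Ω(∑ₖ pₖ ρₖ)) - ∑ₖ pₖ S(Ω(ρₖ))` over all finite ensembles
`{pₖ, ρₖ}` of input states. -/
def holevoQuantities {m n : Type*} [Fintype m] [Fintype n] [DecidableEq n]
    (Ω : Matrix m m ℂ →ₗ[ℂ] Matrix n n ℂ) : Set ℝ :=
  {x | ∃ (K : ℕ) (p : Fin K → ℝ) (ρ : Fin K → Matrix m m ℂ),
    (∀ k, 0 ≤ p k) ∧ ∑ k, p k = 1 ∧ (∀ k, IsDensityMatrix (ρ k)) ∧
    x = vonNeumannEntropy (Ω (∑ k, (p k : ℂ) • ρ k)) - ∑ k, p k * vonNeumannEntropy (Ω (ρ k))}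

/-- The Holevo capacity `χ*(Ω)`, the supremum of the Holevo quantities. For a channel with a
nonzero input space this is a supremum of a nonempty set that is bounded above, see
`holevoQuantities_nonempty` and `holevoQuantities_bddAbove`. -/
def holevoCapacity {m n : Type*} [Fintype m] [Fintype n] [DecidableEq n]
    (Ω : Matrix m m ℂ →ₗ[ℂ] Matrix n n ℂ) : ℝ :=
  sSup (holevoQuantities Ω)

/-! ### Well-definedness of the notions above -/

theorem tensorMap_kronecker {m n m' n' : Type*} (Φ : Matrix m m ℂ →ₗ[ℂ] Matrix n n ℂ)
    (Ω : Matrix m' m' ℂ →ₗ[ℂ] Matrix n' n' ℂ) (A : Matrix m m ℂ) (B : Matrix m' m' ℂ) :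
    tensorMap Φ Ω (A ⊗ₖ B) = Φ A ⊗ₖ Ω B := by
  ext p q
  have h : (Matrix.of fun i j => A i j * Ω B p.2 q.2) = Ω B p.2 q.2 • A := by
    ext i j
    simp [mul_comm]
  change Φ (Matrix.of fun i j => Ω (A i j • B) p.2 q.2) p.1 q.1 = _
  simp only [map_smul, Matrix.smul_apply, smul_eq_mul, h, Matrix.kroneckerMap_apply, mul_comm]

theorem tensorMap_unique {m n m' n' : Type*} [Fintype m] [DecidableEq m] [Fintype m']
    [DecidableEq m'] (Φ : Matrix m m ℂ →ₗ[ℂ] Matrix n n ℂ)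
    (Ω : Matrix m' m' ℂ →ₗ[ℂ] Matrix n' n' ℂ)
    (T : Matrix (m × m') (m × m') ℂ →ₗ[ℂ] Matrix (n × n') (n × n') ℂ)
    (hT : ∀ A B, T (A ⊗ₖ B) = Φ A ⊗ₖ Ω B) : T = tensorMap Φ Ω := by
  apply LinearMap.ext
  intro A
  rw [Matrix.matrix_eq_sum_single A]
  simp only [map_sum]
  refine Finset.sum_congr rfl fun p _ => Finset.sum_congr rfl fun q _ => ?_
  have h : Matrix.single p q (A p q) =
      Matrix.single p.1 q.1 (A p q) ⊗ₖ Matrix.single p.2 q.2 (1 : ℂ) := by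
    rw [Matrix.single_kronecker_single, mul_one]
  rw [h, hT, tensorMap_kronecker]

theorem IsChannel.amplification_posSemidef {m n ι : Type*} [Fintype m] [Fintype n] [Fintype ι]
    {Φ : Matrix m m ℂ →ₗ[ℂ] Matrix n n ℂ} (hΦ : IsChannel Φ)
    {M : Matrix (ι × m) (ι × m) ℂ} (hM : M.PosSemidef) : (amplification ι Φ M).PosSemidef := by
  let e := Fintype.equivFin ι
  have h := hΦ.completelyPositive (Fintype.card ι) _
    (hM.submatrix (fun p : Fin (Fintype.card ι) × m => (e.symm p.1, p.2)))
  have h' := h.submatrix (fun p : ι × n => (e p.1, p.2))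
  convert h' using 1
  ext p q
  simp [amplification]

theorem IsChannel.map_posSemidef {m n : Type*} [Fintype m] [Fintype n]
    {Φ : Matrix m m ℂ →ₗ[ℂ] Matrix n n ℂ} (hΦ : IsChannel Φ)
    {A : Matrix m m ℂ} (hA : A.PosSemidef) : (Φ A).PosSemidef :=
  (hΦ.amplification_posSemidef (ι := Unit) (hA.submatrix Prod.snd)).submatrix (fun x => ((), x))

theorem IsChannel.map_isDensityMatrix {m n : Type*} [Fintype m] [Fintype n]
    {Φ : Matrix m m ℂ →ₗ[ℂ] Matrix n n ℂ} (hΦ : IsChannel Φ)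
    {ρ : Matrix m m ℂ} (hρ : IsDensityMatrix ρ) : IsDensityMatrix (Φ ρ) :=
  ⟨hΦ.map_posSemidef hρ.posSemidef, by rw [hΦ.trace_map, hρ.trace_eq_one]⟩

theorem IsChannel.tensorMap {m n m' n' : Type*} [Fintype m] [Fintype n] [Fintype m'] [Fintype n']
    {Φ : Matrix m m ℂ →ₗ[ℂ] Matrix n n ℂ} {Ω : Matrix m' m' ℂ →ₗ[ℂ] Matrix n' n' ℂ}
    (hΦ : IsChannel Φ) (hΩ : IsChannel Ω) : IsChannel (tensorMap Φ Ω) where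
  completelyPositive k M hM := by
    have h1 := hΩ.amplification_posSemidef
      (hM.submatrix (fun p : (Fin k × m) × m' => (p.1.1, p.1.2, p.2)))
    have h2 := hΦ.amplification_posSemidef
      (h1.submatrix (fun p : (Fin k × n') × m => ((p.1.1, p.2), p.1.2)))
    exact h2.submatrix (fun p : Fin k × n × n' => ((p.1, p.2.2), p.2.1))
  trace_map A := by
    have h1 : ∀ x : n', ∑ a, Φ (Matrix.of fun i j =>
        Ω (Matrix.of fun k l => A (i, k) (j, l)) x x) a a =
        ∑ i, Ω (Matrix.of fun k l => A (i, k) (i, l)) x x := fun x => hΦ.trace_map _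
    have h2 : ∀ i : m, ∑ x, Ω (Matrix.of fun k l => A (i, k) (i, l)) x x =
        ∑ k, A (i, k) (i, k) := fun i => hΩ.trace_map _
    calc (Quantum.tensorMap Φ Ω A).trace
        = ∑ p : n × n', Φ (Matrix.of fun i j =>
            Ω (Matrix.of fun k l => A (i, k) (j, l)) p.2 p.2) p.1 p.1 := rfl
      _ = ∑ x : n', ∑ a : n, Φ (Matrix.of fun i j =>
            Ω (Matrix.of fun k l => A (i, k) (j, l)) x x) a a := Fintype.sum_prod_type_right _
      _ = ∑ i, ∑ x, Ω (Matrix.of fun k l => A (i, k) (i, l)) x x := by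
          rw [Finset.sum_comm (s := (Finset.univ : Finset m))]
          exact Finset.sum_congr rfl fun x _ => h1 x
      _ = ∑ i, ∑ k, A (i, k) (i, k) := Finset.sum_congr rfl fun i _ => h2 i
      _ = A.trace := (Fintype.sum_prod_type fun p : m × m' => A p p).symm

theorem vonNeumannEntropy_nonneg {n : Type*} [Fintype n] [DecidableEq n] {ρ : Matrix n n ℂ}
    (hρ : IsDensityMatrix ρ) : 0 ≤ vonNeumannEntropy ρ := by
  have hH := hρ.posSemidef.isHermitian
  rw [vonNeumannEntropy, dif_pos hH]
  have h0 : ∀ i, 0 ≤ hH.eigenvalues i := hρ.posSemidef.eigenvalues_nonneg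
  have hs : ∑ i, hH.eigenvalues i = 1 := by
    have h := hH.trace_eq_sum_eigenvalues
    rw [hρ.trace_eq_one] at h
    exact Complex.ofReal_injective (by simpa using h.symm)
  exact Finset.sum_nonneg fun i hi => Real.negMulLog_nonneg (h0 i)
    (hs ▸ Finset.single_le_sum (fun j _ => h0 j) hi)

theorem vonNeumannEntropy_le_card {n : Type*} [Fintype n] [DecidableEq n] {ρ : Matrix n n ℂ}
    (hρ : IsDensityMatrix ρ) : vonNeumannEntropy ρ ≤ Fintype.card n := by
  have hH := hρ.posSemidef.isHermitian
  rw [vonNeumannEntropy, dif_pos hH]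
  have h0 : ∀ i, 0 ≤ hH.eigenvalues i := hρ.posSemidef.eigenvalues_nonneg
  have h1 : ∀ i, Real.negMulLog (hH.eigenvalues i) ≤ 1 := fun i =>
    (Real.negMulLog_le_one_sub_self (h0 i)).trans (by linarith [h0 i])
  calc _ ≤ ∑ _i : n, (1 : ℝ) := Finset.sum_le_sum fun i _ => h1 i
    _ = _ := by simp

theorem IsDensityMatrix.sum_smul {m : Type*} [Fintype m] {K : ℕ} {p : Fin K → ℝ}
    {ρ : Fin K → Matrix m m ℂ} (hp : ∀ k, 0 ≤ p k) (hs : ∑ k, p k = 1)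
    (hρ : ∀ k, IsDensityMatrix (ρ k)) : IsDensityMatrix (∑ k, (p k : ℂ) • ρ k) where
  posSemidef := Matrix.posSemidef_sum _ fun k _ =>
    (hρ k).posSemidef.smul (by exact_mod_cast hp k)
  trace_eq_one := by
    simp only [Matrix.trace_sum, Matrix.trace_smul, (hρ _).trace_eq_one, smul_eq_mul, mul_one]
    exact_mod_cast hs

theorem holevoQuantities_nonempty {m n : Type*} [Fintype m] [Nonempty m] [Fintype n]
    [DecidableEq n] (Ω : Matrix m m ℂ →ₗ[ℂ] Matrix n n ℂ) : (holevoQuantities Ω).Nonempty := by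
  classical
  obtain ⟨i⟩ := ‹Nonempty m›
  refine ⟨_, 1, fun _ => 1, fun _ => Matrix.diagonal (Pi.single i 1), by simp, by simp,
    fun _ => ⟨?_, by simp [Matrix.trace]⟩, rfl⟩
  refine Matrix.PosSemidef.diagonal ?_
  exact Pi.single_nonneg.2 zero_le_one

theorem holevoQuantities_bddAbove {m n : Type*} [Fintype m] [Fintype n] [DecidableEq n]
    {Ω : Matrix m m ℂ →ₗ[ℂ] Matrix n n ℂ} (hΩ : IsChannel Ω) : BddAbove (holevoQuantities Ω) := by
  refine ⟨Fintype.card n, ?_⟩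
  rintro x ⟨K, p, ρ, hp, hs, hρ, rfl⟩
  have h1 := vonNeumannEntropy_le_card
    (hΩ.map_isDensityMatrix (IsDensityMatrix.sum_smul hp hs hρ))
  have h2 : 0 ≤ ∑ k, p k * vonNeumannEntropy (Ω (ρ k)) := Finset.sum_nonneg fun k _ =>
    mul_nonneg (hp k) (vonNeumannEntropy_nonneg (hΩ.map_isDensityMatrix (hρ k)))
  linarith

theorem IsEntanglementBreaking.isChannel {m n : Type*} [Fintype m] [DecidableEq m] [Fintype n]
    {Φ : Matrix m m ℂ →ₗ[ℂ] Matrix n n ℂ} (hΦ : IsEntanglementBreaking Φ) : IsChannel Φ := by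
  obtain ⟨K, R, X, hR, hX, hsum, hΦ⟩ := hΦ
  refine ⟨fun d M hM => ?_, fun A => ?_⟩
  · have h : amplification (Fin d) Φ M = ∑ k, (Matrix.of fun i j =>
        (X k * Matrix.of fun x y => M (i, x) (j, y)).trace) ⊗ₖ R k := by
      ext p q
      simp [amplification, hΦ, Matrix.sum_apply]
    rw [h]
    refine Matrix.posSemidef_sum _ fun k _ => Matrix.PosSemidef.kronecker ?_ (hR k).posSemidef
    obtain ⟨B, hB⟩ : ∃ B, X k = Bᴴ * B := by
      open scoped MatrixOrder in
      exact CStarAlgebra.nonneg_iff_eq_star_mul_self.mp (hX k).nonneg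
    have hN := hM.mul_mul_conjTranspose_same ((1 : Matrix (Fin d) (Fin d) ℂ) ⊗ₖ B)
    have h' : (Matrix.of fun i j => (X k * Matrix.of fun x y => M (i, x) (j, y)).trace) =
        ∑ a : m, (((1 : Matrix (Fin d) (Fin d) ℂ) ⊗ₖ B) * M *
          ((1 : Matrix (Fin d) (Fin d) ℂ) ⊗ₖ B)ᴴ).submatrix (fun i => (i, a)) fun i => (i, a) := by
      ext i j
      rw [Matrix.of_apply, hB, Matrix.mul_assoc, Matrix.trace_mul_comm, Matrix.sum_apply]
      refine Finset.sum_congr rfl fun a _ => ?_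
      simp [Matrix.mul_apply, Fintype.sum_prod_type, Matrix.one_apply, Finset.sum_mul]
      rw [Finset.sum_eq_single (M := ℂ) j (fun x _ hx => by simp [hx.symm]) (by simp)]
      simp
    rw [h']
    exact Matrix.posSemidef_sum _ fun a _ => hN.submatrix _
  · rw [hΦ, Matrix.trace_sum]
    simp only [Matrix.trace_smul, (hR _).trace_eq_one, smul_eq_mul, mul_one]
    rw [← Matrix.trace_sum, ← Finset.sum_mul, hsum, one_mul]

end Quantum

end

noncomputable section

namespace Quantum

/-! ### Spectral decompositions -/

/-! The inequality `≥` comes from product ensembles, since entropy is additive on product states.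

For `≤`, let `Φ` measure a POVM `X_k` and prepare `R_k`. On an input `ρ_i` the measurement gives
outcome `k` with probability `t_ik` and leaves the second factor in a state `τ_ik`, so the output is
the separable state `∑_k t_ik R_k ⊗ Ω(τ_ik)`. Two entropy inequalities then suffice. Subadditivity
bounds the entropy of the average output by the entropies of its marginals, which are the average
outputs of `Φ` on the reduced states of the `ρ_i` and of `Ω` on the ensemble `{p_i t_ik, τ_ik}`. The
bound `S(∑ t_k R_k ⊗ σ_k) ≥ S(∑ t_k R_k) + ∑ t_k S(σ_k)` (`vonNeumannEntropy_separable_ge`) splits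
each subtracted term accordingly, so the Holevo quantity of `Φ ⊗ Ω` is at most the sum of those of
these two ensembles.

The separable bound is joint convexity of the relative entropy, applied to the pairs `t_k R_k ⊗ σ_k`
and `t_k R_k ⊗ 1`. Joint convexity (`spectralRelEntropy_sum_le`) is proved by writing the relative
entropy as an integral over `s ∈ (0, 1)` of quadratic quantities `spectralChiSq`, each of which is a
supremum of functionals linear in the pair `(A, B)` and hence subadditive. All of this is computed
in explicit eigenbases `U`, `V`, where only the weights `|(Uᴴ V) i j|²` appear. -/

/-- `A = U diag(a) Uᴴ` with `U` unitary. -/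
structure IsSpectralDecomp {n : Type*} [Fintype n] [DecidableEq n] (A U : Matrix n n ℂ)
    (a : n → ℝ) : Prop where
  mem_unitaryGroup : U ∈ Matrix.unitaryGroup n ℂ
  eq : A = U * Matrix.diagonal (fun i => (a i : ℂ)) * Uᴴ

section SpectralDecomp

variable {n n' : Type*} [Fintype n] [DecidableEq n] [Fintype n'] [DecidableEq n']

theorem conjTranspose_mul_self_of_mem_unitaryGroup {U : Matrix n n ℂ}
    (hU : U ∈ Matrix.unitaryGroup n ℂ) : Uᴴ * U = 1 :=
  Matrix.mem_unitaryGroup_iff'.1 hU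

theorem mul_conjTranspose_self_of_mem_unitaryGroup {U : Matrix n n ℂ}
    (hU : U ∈ Matrix.unitaryGroup n ℂ) : U * Uᴴ = 1 :=
  Matrix.mem_unitaryGroup_iff.1 hU

theorem exists_isSpectralDecomp {A : Matrix n n ℂ} (hA : A.PosSemidef) :
    ∃ U a, IsSpectralDecomp A U a ∧ ∀ i, 0 ≤ a i :=
  ⟨hA.isHermitian.eigenvectorUnitary, hA.isHermitian.eigenvalues,
    ⟨hA.isHermitian.eigenvectorUnitary.2, by
      conv_lhs => rw [hA.isHermitian.spectral_theorem, Unitary.conjStarAlgAut_apply]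
      rfl⟩, hA.eigenvalues_nonneg⟩

theorem IsSpectralDecomp.isHermitian {A U : Matrix n n ℂ} {a : n → ℝ}
    (h : IsSpectralDecomp A U a) : A.IsHermitian := by
  rw [h.eq]
  refine Matrix.isHermitian_mul_mul_conjTranspose _ ?_
  simp [Matrix.IsHermitian, Matrix.diagonal_conjTranspose, Pi.star_def]

theorem IsSpectralDecomp.trace_eq_sum {A U : Matrix n n ℂ} {a : n → ℝ}
    (h : IsSpectralDecomp A U a) : A.trace = ∑ i, (a i : ℂ) := by
  rw [h.eq, Matrix.trace_mul_comm, ← Matrix.mul_assoc,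
    conjTranspose_mul_self_of_mem_unitaryGroup h.mem_unitaryGroup, Matrix.one_mul,
    Matrix.trace_diagonal]

theorem IsSpectralDecomp.conj_eq {A U : Matrix n n ℂ} {a : n → ℝ}
    (h : IsSpectralDecomp A U a) :
    Uᴴ * A * U = Matrix.diagonal (fun i => (a i : ℂ)) := by
  have hU := conjTranspose_mul_self_of_mem_unitaryGroup h.mem_unitaryGroup
  calc Uᴴ * A * U = (Uᴴ * U) * Matrix.diagonal (fun i => (a i : ℂ)) * (Uᴴ * U) := by
        rw [h.eq]; simp only [Matrix.mul_assoc]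
    _ = _ := by rw [hU, Matrix.one_mul, Matrix.mul_one]

/-- Frees the entropy from the particular eigenbasis in its definition: the eigenvalues and the `a
i` are both the multiset of roots of the characteristic polynomial. -/
theorem IsSpectralDecomp.entropy_eq {A U : Matrix n n ℂ} {a : n → ℝ}
    (h : IsSpectralDecomp A U a) : vonNeumannEntropy A = ∑ i, Real.negMulLog (a i) := by
  have hH := h.isHermitian
  have hc : A.charpoly = ∏ i, (Polynomial.X - Polynomial.C (a i : ℂ)) := by
    conv_lhs => rw [h.eq, Matrix.charpoly_mul_comm, ← Matrix.mul_assoc,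
      conjTranspose_mul_self_of_mem_unitaryGroup h.mem_unitaryGroup, Matrix.one_mul]
    simp [Matrix.charpoly_diagonal]
  have hroots : A.charpoly.roots = Multiset.map (fun i => (a i : ℂ)) Finset.univ.val := by
    rw [hc, Polynomial.roots_prod _ _ (by
      rw [Finset.prod_ne_zero_iff]; exact fun i _ => Polynomial.X_sub_C_ne_zero _)]
    simp
  have hm := hH.roots_charpoly_eq_eigenvalues.symm.trans hroots
  have hm' := congrArg (fun s : Multiset ℂ =>
    (s.map fun z => Real.negMulLog z.re).sum) hm
  rw [vonNeumannEntropy, dif_pos hH]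
  simp only [Multiset.map_map] at hm'
  exact hm'

theorem IsSpectralDecomp.kronecker {A U : Matrix n n ℂ} {a : n → ℝ} {B V : Matrix n' n' ℂ}
    {b : n' → ℝ} (hA : IsSpectralDecomp A U a) (hB : IsSpectralDecomp B V b) :
    IsSpectralDecomp (A ⊗ₖ B) (U ⊗ₖ V) fun p => a p.1 * b p.2 where
  mem_unitaryGroup := Matrix.kronecker_mem_unitary hA.mem_unitaryGroup hB.mem_unitaryGroup
  eq := by
    rw [hA.eq, hB.eq, Matrix.conjTranspose_kronecker, Matrix.mul_kronecker_mul,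
      Matrix.mul_kronecker_mul, Matrix.diagonal_kronecker_diagonal]
    simp

theorem IsSpectralDecomp.smul {A U : Matrix n n ℂ} {a : n → ℝ} (h : IsSpectralDecomp A U a)
    (c : ℝ) : IsSpectralDecomp ((c : ℂ) • A) U fun i => c * a i where
  mem_unitaryGroup := h.mem_unitaryGroup
  eq := by
    rw [h.eq, ← Matrix.smul_mul, ← Matrix.mul_smul, ← Matrix.diagonal_smul]
    simp [Pi.smul_def]

theorem isSpectralDecomp_one {U : Matrix n n ℂ} (hU : U ∈ Matrix.unitaryGroup n ℂ) :
    IsSpectralDecomp 1 U fun _ => 1 where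
  mem_unitaryGroup := hU
  eq := by simp [mul_conjTranspose_self_of_mem_unitaryGroup hU]

/-- The diagonal in a new basis is the spectrum averaged with the weights `|(Uᴴ V) i j|²`, which are
doubly stochastic when `V` is unitary as well. -/
theorem IsSpectralDecomp.diag_conj {A U : Matrix n n ℂ} {a : n → ℝ}
    (h : IsSpectralDecomp A U a) (V : Matrix n n ℂ) (j : n) :
    (Vᴴ * A * V) j j = ((∑ i, Complex.normSq ((Uᴴ * V) i j) * a i : ℝ) : ℂ) := by
  have e : Vᴴ * A * V = (Uᴴ * V)ᴴ * Matrix.diagonal (fun i => (a i : ℂ)) * (Uᴴ * V) := by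
    rw [h.eq, Matrix.conjTranspose_mul, Matrix.conjTranspose_conjTranspose]
    simp only [Matrix.mul_assoc]
  rw [e, Matrix.mul_apply]
  push_cast
  refine Finset.sum_congr rfl fun i _ => ?_
  rw [Matrix.mul_diagonal, Matrix.conjTranspose_apply, Complex.normSq_eq_conj_mul_self]
  simp only [RCLike.star_def]
  ring

theorem sum_normSq_col {W : Matrix n n ℂ} (hW : W ∈ Matrix.unitaryGroup n ℂ) (j : n) :
    ∑ i, Complex.normSq (W i j) = 1 := by
  have h := congrFun (congrFun (conjTranspose_mul_self_of_mem_unitaryGroup hW) j) j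
  rw [Matrix.mul_apply, Matrix.one_apply_eq] at h
  have h' : ((∑ i, Complex.normSq (W i j) : ℝ) : ℂ) = 1 := by
    rw [← h]
    push_cast
    simp [Complex.normSq_eq_conj_mul_self]
  exact_mod_cast h'

theorem sum_normSq_row {W : Matrix n n ℂ} (hW : W ∈ Matrix.unitaryGroup n ℂ) (i : n) :
    ∑ j, Complex.normSq (W i j) = 1 := by
  have h := sum_normSq_col (Unitary.star_mem hW) i
  simpa [Matrix.star_eq_conjTranspose] using h

theorem conjTranspose_mul_mem_unitaryGroup {U V : Matrix n n ℂ}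
    (hU : U ∈ Matrix.unitaryGroup n ℂ) (hV : V ∈ Matrix.unitaryGroup n ℂ) :
    Uᴴ * V ∈ Matrix.unitaryGroup n ℂ :=
  mul_mem (Unitary.star_mem hU) hV

/-- The entropy of a state is at most the Shannon entropy of its diagonal in any orthonormal
basis. -/
theorem vonNeumannEntropy_le_diag {A V : Matrix n n ℂ} (hA : A.PosSemidef)
    (hV : V ∈ Matrix.unitaryGroup n ℂ) :
    vonNeumannEntropy A ≤ ∑ j, Real.negMulLog ((Vᴴ * A * V) j j).re := by
  obtain ⟨U, a, h, ha⟩ := exists_isSpectralDecomp hA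
  have hW := conjTranspose_mul_mem_unitaryGroup h.mem_unitaryGroup hV
  calc vonNeumannEntropy A
      = ∑ i, (∑ j, Complex.normSq ((Uᴴ * V) i j)) * Real.negMulLog (a i) := by
        simp only [sum_normSq_row hW, one_mul, h.entropy_eq]
    _ = ∑ j, ∑ i, Complex.normSq ((Uᴴ * V) i j) • Real.negMulLog (a i) := by
        simp only [Finset.sum_mul, smul_eq_mul]
        exact Finset.sum_comm
    -- Jensen for the concave `-x log x`, with the column weights as a probability vector.
    _ ≤ ∑ j, Real.negMulLog (∑ i, Complex.normSq ((Uᴴ * V) i j) • a i) :=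
        Finset.sum_le_sum fun j _ => Real.concaveOn_negMulLog.le_map_sum
          (fun i _ => Complex.normSq_nonneg _) (sum_normSq_col hW j) fun i _ => ha i
    _ = _ := by simp only [h.diag_conj, Complex.ofReal_re, smul_eq_mul]

end SpectralDecomp

/-! ### Partial traces and subadditivity -/

section PartialTrace

variable {n n' : Type*}

/-- The partial trace over the second tensor factor. -/
def traceSnd [Fintype n'] (A : Matrix (n × n') (n × n') ℂ) : Matrix n n ℂ :=
  Matrix.of fun i j => ∑ k, A (i, k) (j, k)

/-- The partial trace over the first tensor factor. -/
def traceFst [Fintype n] (A : Matrix (n × n') (n × n') ℂ) : Matrix n' n' ℂ :=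
  Matrix.of fun k l => ∑ i, A (i, k) (i, l)

theorem traceSnd_eq_sum_submatrix [Fintype n'] (A : Matrix (n × n') (n × n') ℂ) :
    traceSnd A = ∑ k, A.submatrix (fun i => (i, k)) fun i => (i, k) := by
  ext; simp [traceSnd, Matrix.sum_apply]

theorem traceFst_eq_sum_submatrix [Fintype n] (A : Matrix (n × n') (n × n') ℂ) :
    traceFst A = ∑ i, A.submatrix (fun k => (i, k)) fun k => (i, k) := by
  ext; simp [traceFst, Matrix.sum_apply]

theorem traceFst_eq_traceSnd_swap [Fintype n] (A : Matrix (n × n') (n × n') ℂ) :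
    traceFst A = traceSnd (A.submatrix Prod.swap Prod.swap) := rfl

theorem traceSnd_sum [Fintype n'] {ι : Type*} (s : Finset ι) (A : ι → Matrix (n × n') (n × n') ℂ) :
    traceSnd (∑ x ∈ s, A x) = ∑ x ∈ s, traceSnd (A x) := by
  ext i j
  simp only [traceSnd, Matrix.of_apply, Matrix.sum_apply]
  exact Finset.sum_comm

theorem traceFst_sum [Fintype n] {ι : Type*} (s : Finset ι) (A : ι → Matrix (n × n') (n × n') ℂ) :
    traceFst (∑ x ∈ s, A x) = ∑ x ∈ s, traceFst (A x) := by
  ext i j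
  simp only [traceFst, Matrix.of_apply, Matrix.sum_apply]
  exact Finset.sum_comm

theorem traceSnd_smul [Fintype n'] (c : ℂ) (A : Matrix (n × n') (n × n') ℂ) :
    traceSnd (c • A) = c • traceSnd A := by
  ext i j
  simp [traceSnd, Finset.mul_sum]

theorem traceFst_smul [Fintype n] (c : ℂ) (A : Matrix (n × n') (n × n') ℂ) :
    traceFst (c • A) = c • traceFst A := by
  ext i j
  simp [traceFst, Finset.mul_sum]

theorem traceSnd_kronecker [Fintype n'] (A : Matrix n n ℂ) (B : Matrix n' n' ℂ) :
    traceSnd (A ⊗ₖ B) = B.trace • A := by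
  ext i j
  simp [traceSnd, Matrix.trace, ← Finset.mul_sum, mul_comm]

theorem traceFst_kronecker [Fintype n] (A : Matrix n n ℂ) (B : Matrix n' n' ℂ) :
    traceFst (A ⊗ₖ B) = A.trace • B := by
  ext i j
  simp [traceFst, Matrix.trace, ← Finset.sum_mul]

variable [Fintype n] [Fintype n']

theorem trace_traceSnd (A : Matrix (n × n') (n × n') ℂ) : (traceSnd A).trace = A.trace := by
  simp [Matrix.trace, traceSnd, Fintype.sum_prod_type]

theorem trace_traceFst (A : Matrix (n × n') (n × n') ℂ) : (traceFst A).trace = A.trace := by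
  simp [Matrix.trace, traceFst, Fintype.sum_prod_type_right]

theorem IsDensityMatrix.traceSnd {A : Matrix (n × n') (n × n') ℂ} (hA : IsDensityMatrix A) :
    IsDensityMatrix (traceSnd A) where
  posSemidef := by
    rw [traceSnd_eq_sum_submatrix]
    exact Matrix.posSemidef_sum _ fun k _ => hA.posSemidef.submatrix _
  trace_eq_one := by rw [trace_traceSnd, hA.trace_eq_one]

theorem IsDensityMatrix.traceFst {A : Matrix (n × n') (n × n') ℂ} (hA : IsDensityMatrix A) :
    IsDensityMatrix (traceFst A) where
  posSemidef := by
    rw [traceFst_eq_sum_submatrix]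
    exact Matrix.posSemidef_sum _ fun k _ => hA.posSemidef.submatrix _
  trace_eq_one := by rw [trace_traceFst, hA.trace_eq_one]

/-- A unitary on the factor being traced out cancels; no condition on `U` is needed. -/
theorem traceSnd_conj_kronecker [DecidableEq n'] (A : Matrix (n × n') (n × n') ℂ) (U : Matrix n n ℂ)
    {V : Matrix n' n' ℂ} (hV : V ∈ Matrix.unitaryGroup n' ℂ) :
    traceSnd ((U ⊗ₖ V)ᴴ * A * (U ⊗ₖ V)) = Uᴴ * traceSnd A * U := by
  have hV' : ∀ x y, ∑ k, V x k * star (V y k) = if x = y then 1 else 0 := fun x y => by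
    have h := congrFun (congrFun (mul_conjTranspose_self_of_mem_unitaryGroup hV) x) y
    simpa [Matrix.mul_apply, Matrix.one_apply] using h
  ext i j
  calc (traceSnd ((U ⊗ₖ V)ᴴ * A * (U ⊗ₖ V))) i j
      = ∑ k, ∑ q : n × n', ∑ p : n × n',
          star (U p.1 i * V p.2 k) * A p q * (U q.1 j * V q.2 k) := by
        simp [traceSnd, Matrix.mul_apply, Finset.sum_mul]
    _ = ∑ q : n × n', ∑ p : n × n', star (U p.1 i) * A p q * U q.1 j *
          ∑ k, V q.2 k * star (V p.2 k) := by
        rw [Finset.sum_comm]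
        refine Finset.sum_congr rfl fun q _ => ?_
        rw [Finset.sum_comm]
        refine Finset.sum_congr rfl fun p _ => ?_
        rw [Finset.mul_sum]
        refine Finset.sum_congr rfl fun k _ => ?_
        rw [star_mul']
        ring
    _ = _ := by
        simp only [hV', Fintype.sum_prod_type, mul_ite, mul_one, mul_zero, Finset.sum_ite_eq,
          Finset.mem_univ, if_true, traceSnd, Matrix.mul_apply, Matrix.of_apply,
          Matrix.conjTranspose_apply, Finset.sum_mul, Finset.mul_sum]
        refine Finset.sum_congr rfl fun q _ => ?_
        rw [Finset.sum_comm]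

theorem traceFst_conj_kronecker [DecidableEq n] (A : Matrix (n × n') (n × n') ℂ) {U : Matrix n n ℂ}
    (hU : U ∈ Matrix.unitaryGroup n ℂ) (V : Matrix n' n' ℂ) :
    traceFst ((U ⊗ₖ V)ᴴ * A * (U ⊗ₖ V)) = Vᴴ * traceFst A * V := by
  rw [traceFst_eq_traceSnd_swap, traceFst_eq_traceSnd_swap, ← traceSnd_conj_kronecker _ _ hU]
  congr 1
  have e : V ⊗ₖ U = (U ⊗ₖ V).submatrix Prod.swap Prod.swap := by
    ext; simp [mul_comm]
  rw [e, Matrix.conjTranspose_submatrix,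
    Matrix.submatrix_mul _ _ _ Prod.swap _ (Equiv.prodComm n' n).bijective,
    Matrix.submatrix_mul _ _ _ Prod.swap _ (Equiv.prodComm n' n).bijective]

end PartialTrace

/-- Subadditivity of the Shannon entropy. -/
theorem sum_negMulLog_le_marginals {n n' : Type*} [Fintype n] [Fintype n'] {p : n × n' → ℝ}
    (hp : ∀ x, 0 ≤ p x) (hs : ∑ x, p x = 1) :
    ∑ x, Real.negMulLog (p x) ≤ ∑ i, Real.negMulLog (∑ j, p (i, j)) +
      ∑ j, Real.negMulLog (∑ i, p (i, j)) := by
  set a : n → ℝ := fun i => ∑ j, p (i, j) with ha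
  set b : n' → ℝ := fun j => ∑ i, p (i, j) with hb
  have hpa : ∀ x, p x ≤ a x.1 := fun x =>
    Finset.single_le_sum (f := fun j => p (x.1, j)) (fun j _ => hp _) (Finset.mem_univ x.2)
  have hpb : ∀ x, p x ≤ b x.2 := fun x =>
    Finset.single_le_sum (f := fun i => p (i, x.2)) (fun j _ => hp _) (Finset.mem_univ x.1)
  -- This is `log y ≤ y - 1` at `y = a b / p`. After summation the linear terms `-p + a b` cancel,
  -- both having total mass one.
  have key : ∀ x, Real.negMulLog (p x) ≤
      -p x * Real.log (a x.1) - p x * Real.log (b x.2) - p x + a x.1 * b x.2 := fun x => by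
    rcases (hp x).eq_or_lt with h | h
    · rw [← h]
      simpa using mul_nonneg ((hp x).trans (hpa x)) ((hp x).trans (hpb x))
    · have h1 := h.trans_le (hpa x)
      have h2 := h.trans_le (hpb x)
      have h3 := Real.log_le_sub_one_of_pos (div_pos (mul_pos h1 h2) h)
      rw [Real.log_div (mul_pos h1 h2).ne' h.ne', Real.log_mul h1.ne' h2.ne'] at h3
      have h4 := mul_le_mul_of_nonneg_left h3 h.le
      have h5 : p x * (a x.1 * b x.2 / p x - 1) = a x.1 * b x.2 - p x := by
        field_simp
      rw [Real.negMulLog]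
      linarith
  have hsa : ∑ i, a i = 1 := by rw [← hs, Fintype.sum_prod_type]
  have hsb : ∑ j, b j = 1 := by rw [← hs, Fintype.sum_prod_type_right]
  have e1 : ∑ x : n × n', p x * Real.log (a x.1) = ∑ i, a i * Real.log (a i) := by
    rw [Fintype.sum_prod_type]
    exact Finset.sum_congr rfl fun i _ => by simp only [ha, Finset.sum_mul]
  have e2 : ∑ x : n × n', p x * Real.log (b x.2) = ∑ j, b j * Real.log (b j) := by
    rw [Fintype.sum_prod_type_right]
    exact Finset.sum_congr rfl fun i _ => by simp only [hb, Finset.sum_mul]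
  have e3 : ∑ x : n × n', a x.1 * b x.2 = 1 := by
    rw [Fintype.sum_prod_type, ← Finset.sum_mul_sum, hsa, hsb, one_mul]
  refine (Finset.sum_le_sum fun x _ => key x).trans_eq ?_
  simp only [Finset.sum_add_distrib, Finset.sum_sub_distrib, neg_mul, Finset.sum_neg_distrib,
    e1, e2, e3, hs, Real.negMulLog]
  ring

/-- Subadditivity of the von Neumann entropy. -/
theorem vonNeumannEntropy_le_traceSnd_add_traceFst {n n' : Type*} [Fintype n] [DecidableEq n]
    [Fintype n'] [DecidableEq n'] {A : Matrix (n × n') (n × n') ℂ} (hA : IsDensityMatrix A) :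
    vonNeumannEntropy A ≤ vonNeumannEntropy (traceSnd A) + vonNeumannEntropy (traceFst A) := by
  obtain ⟨U, a, hU, -⟩ := exists_isSpectralDecomp hA.traceSnd.posSemidef
  obtain ⟨V, b, hV, -⟩ := exists_isSpectralDecomp hA.traceFst.posSemidef
  have hUV := Matrix.kronecker_mem_unitary hU.mem_unitaryGroup hV.mem_unitaryGroup
  -- In the product of the eigenbases of the two marginals, the diagonal of `A` is a joint
  -- distribution whose marginals are the spectra `a` and `b`. This reduces the claim to the Shannon
  -- case.
  set C := (U ⊗ₖ V)ᴴ * A * (U ⊗ₖ V) with hC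
  have hCp : C.PosSemidef := hA.posSemidef.conjTranspose_mul_mul_same _
  have h1 : ∀ i, ∑ j, (C (i, j) (i, j)).re = a i := fun i => by
    have h := congrFun (congrFun ((traceSnd_conj_kronecker A U hV.mem_unitaryGroup).trans
      hU.conj_eq) i) i
    have h' := congrArg Complex.re h
    simpa [traceSnd, ← hC] using h'
  have h2 : ∀ j, ∑ i, (C (i, j) (i, j)).re = b j := fun j => by
    have h := congrFun (congrFun ((traceFst_conj_kronecker A hU.mem_unitaryGroup V).trans
      hV.conj_eq) j) j
    have h' := congrArg Complex.re h
    simpa [traceFst, ← hC] using h'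
  have hs : ∑ x, (C x x).re = 1 := by
    have h : C.trace = 1 := by
      rw [hC, Matrix.trace_mul_comm, ← Matrix.mul_assoc,
        mul_conjTranspose_self_of_mem_unitaryGroup hUV, Matrix.one_mul, hA.trace_eq_one]
    simpa [Matrix.trace] using congrArg Complex.re h
  have h3 := sum_negMulLog_le_marginals (p := fun x => (C x x).re)
    (fun x => (Complex.nonneg_iff.1 (hCp.diag_nonneg (i := x))).1) hs
  simp only [h1, h2] at h3
  rw [hU.entropy_eq, hV.entropy_eq]
  exact (vonNeumannEntropy_le_diag hA.posSemidef hUV).trans h3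

/-- Additivity of the von Neumann entropy on product states. -/
theorem vonNeumannEntropy_kronecker {n n' : Type*} [Fintype n] [DecidableEq n]
    [Fintype n'] [DecidableEq n'] {A : Matrix n n ℂ} {B : Matrix n' n' ℂ}
    (hA : IsDensityMatrix A) (hB : IsDensityMatrix B) :
    vonNeumannEntropy (A ⊗ₖ B) = vonNeumannEntropy A + vonNeumannEntropy B := by
  obtain ⟨U, a, hU, -⟩ := exists_isSpectralDecomp hA.posSemidef
  obtain ⟨V, b, hV, -⟩ := exists_isSpectralDecomp hB.posSemidef
  have ha : ∑ i, a i = 1 := by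
    have h := hU.trace_eq_sum.symm.trans hA.trace_eq_one
    exact_mod_cast h
  have hb : ∑ i, b i = 1 := by
    have h := hV.trace_eq_sum.symm.trans hB.trace_eq_one
    exact_mod_cast h
  rw [(hU.kronecker hV).entropy_eq, hU.entropy_eq, hV.entropy_eq]
  simp only [Real.negMulLog_mul, Fintype.sum_prod_type, Finset.sum_add_distrib,
    ← Finset.sum_mul, ← Finset.mul_sum, ha, hb, one_mul]

/-! ### Joint convexity of the relative entropy -/

/-- The scalar kernel `a log a - a log b - a + b` of the relative entropy. -/
def relEntropyKernel (a b : ℝ) : ℝ := a * Real.log a - a * Real.log b - a + b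

theorem hasDerivAt_log_segment {a b s : ℝ} (h : s * a + (1 - s) * b ≠ 0) :
    HasDerivAt (fun s => a * Real.log (s * a + (1 - s) * b) - (a - b) * s)
      ((1 - s) * ((a - b) ^ 2 / (s * a + (1 - s) * b))) s := by
  have h1 : HasDerivAt (fun s : ℝ => s * a + (1 - s) * b) (a - b) s := by
    have h2 := ((hasDerivAt_id s).mul_const a).add
      (((hasDerivAt_const s (1 : ℝ)).sub (hasDerivAt_id s)).mul_const b)
    exact h2.congr_deriv (by ring)
  have h3 := ((h1.log h).const_mul a).sub ((hasDerivAt_id s).const_mul (a - b))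
  refine h3.congr_deriv ?_
  generalize hc : s * a + (1 - s) * b = c at h
  field_simp
  rw [← hc]
  ring

/-- The relative entropy kernel is an average of the kernels `(a - b)² / (s a + (1 - s) b)`. -/
theorem integral_relEntropyKernel {a b : ℝ} (ha : 0 ≤ a) (hb : 0 ≤ b) (hab : b = 0 → a = 0) :
    IntervalIntegrable (fun s => (1 - s) * ((a - b) ^ 2 / (s * a + (1 - s) * b)))
      MeasureTheory.volume 0 1 ∧
    ∫ s in (0 : ℝ)..1, (1 - s) * ((a - b) ^ 2 / (s * a + (1 - s) * b)) =
      relEntropyKernel a b := by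
  rcases hb.eq_or_lt with hb | hb
  · obtain rfl := hb
    obtain rfl := hab rfl
    simp [relEntropyKernel]
  rcases ha.eq_or_lt with ha | ha
  · subst ha
    -- For `a = 0` the integrand is constant only on the open interval: at `s = 1` the denominator
    -- vanishes and the value is `0`.
    have e : Set.EqOn (fun _ => b)
        (fun s => (1 - s) * ((0 - b) ^ 2 / (s * 0 + (1 - s) * b))) (Set.Ioo (0 : ℝ) 1) := by
      intro s hs
      have : 1 - s ≠ 0 := by linarith [hs.2]
      simp only
      field_simp
      ring
    have e' : Set.EqOn (fun _ => b)
        (fun s => (1 - s) * ((0 - b) ^ 2 / (s * 0 + (1 - s) * b)))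
        (Set.uIoo (0 : ℝ) 1) := by
      rwa [Set.uIoo_of_le zero_le_one]
    refine ⟨?_, ?_⟩
    · exact (intervalIntegrable_const (μ := MeasureTheory.volume)).congr_uIoo e'
    · rw [← intervalIntegral.integral_congr_uIoo e']
      simp [relEntropyKernel]
  · have hpos : ∀ s ∈ Set.uIcc (0 : ℝ) 1, s * a + (1 - s) * b ≠ 0 := fun s hs => by
      rw [Set.uIcc_of_le zero_le_one] at hs
      rcases hs.1.eq_or_lt with h | h
      · rw [← h]; simpa using hb.ne'
      · have := mul_pos h ha
        have := mul_nonneg (sub_nonneg.2 hs.2) hb.le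
        linarith
    have hint : IntervalIntegrable (fun s => (1 - s) * ((a - b) ^ 2 / (s * a + (1 - s) * b)))
        MeasureTheory.volume 0 1 := by
      refine ContinuousOn.intervalIntegrable ?_
      refine ContinuousOn.mul (by fun_prop) (ContinuousOn.div (by fun_prop) (by fun_prop) hpos)
    refine ⟨hint, ?_⟩
    rw [intervalIntegral.integral_eq_sub_of_hasDerivAt
      (fun s hs => hasDerivAt_log_segment (hpos s hs)) hint]
    simp [relEntropyKernel]
    ring

section JointConvexity

variable {n : Type*} [Fintype n]

/-- For `A = U diag(a) Uᴴ` and `B = V diag(b) Vᴴ` this is the quadratic form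
`⟨A - B, (s L_A + (1 - s) R_B)⁻¹ (A - B)⟩`, where `L` and `R` are left and right multiplication. -/
def spectralChiSq (s : ℝ) (U : Matrix n n ℂ) (a : n → ℝ) (V : Matrix n n ℂ) (b : n → ℝ) : ℝ :=
  ∑ i, ∑ j, Complex.normSq ((Uᴴ * V) i j) * ((a i - b j) ^ 2 / (s * a i + (1 - s) * b j))

/-- The relative entropy `Tr (A log A - A log B - A + B)` of `A = U diag(a) Uᴴ` with respect to
`B = V diag(b) Vᴴ`. -/
def spectralRelEntropy (U : Matrix n n ℂ) (a : n → ℝ) (V : Matrix n n ℂ) (b : n → ℝ) : ℝ :=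
  ∑ i, ∑ j, Complex.normSq ((Uᴴ * V) i j) * relEntropyKernel (a i) (b j)

/-- The functional whose supremum over `Y` is `spectralChiSq`. It is linear in `A` and `B`. -/
def chiSqDual (s : ℝ) (Y A B : Matrix n n ℂ) : ℂ :=
  2 * (Yᴴ * (A - B)).trace - s * (Yᴴ * A * Y).trace - (1 - s) * (Yᴴ * Y * B).trace

theorem chiSqDual_sum {ι : Type*} (t : Finset ι) (s : ℝ) (Y : Matrix n n ℂ)
    (A B : ι → Matrix n n ℂ) :
    chiSqDual s Y (∑ k ∈ t, A k) (∑ k ∈ t, B k) = ∑ k ∈ t, chiSqDual s Y (A k) (B k) := by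
  simp only [chiSqDual, ← Finset.sum_sub_distrib, Matrix.sum_mul,
    Matrix.trace_sum, Finset.mul_sum]

variable [DecidableEq n]

/-- Writing `Y = U Z Vᴴ` diagonalises left multiplication by `A` and right multiplication by `B`
together, so the functional decouples into one scalar quadratic per entry of `Z`. -/
theorem chiSqDual_conj (s : ℝ) (Z : Matrix n n ℂ) {A U B V : Matrix n n ℂ} {a b : n → ℝ}
    (hA : IsSpectralDecomp A U a) (hB : IsSpectralDecomp B V b) :
    (chiSqDual s (U * Z * Vᴴ) A B).re = ∑ i, ∑ j,
      (2 * (star (Z i j) * (Uᴴ * V) i j).re * (a i - b j) -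
        (s * a i + (1 - s) * b j) * Complex.normSq (Z i j)) := by
  have hU := conjTranspose_mul_self_of_mem_unitaryGroup hA.mem_unitaryGroup
  have hV := conjTranspose_mul_self_of_mem_unitaryGroup hB.mem_unitaryGroup
  set W := Uᴴ * V with hW
  have hU' : ∀ M : Matrix n n ℂ, Uᴴ * (U * M) = M := fun M => by
    rw [← Matrix.mul_assoc, hU, Matrix.one_mul]
  have hV' : ∀ M : Matrix n n ℂ, Vᴴ * (V * M) = M := fun M => by
    rw [← Matrix.mul_assoc, hV, Matrix.one_mul]
  have e1 : ((U * Z * Vᴴ)ᴴ * A).trace =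
      (Zᴴ * (Matrix.diagonal (fun i => (a i : ℂ)) * W)).trace := by
    calc _ = (V * (Zᴴ * (Matrix.diagonal (fun i => (a i : ℂ)) * Uᴴ))).trace := by
          rw [hA.eq]; simp [Matrix.conjTranspose_mul, Matrix.mul_assoc, hU']
      _ = _ := by rw [Matrix.trace_mul_comm, hW]; simp only [Matrix.mul_assoc]
  have e2 : ((U * Z * Vᴴ)ᴴ * B).trace =
      (Zᴴ * (W * Matrix.diagonal (fun i => (b i : ℂ)))).trace := by
    calc _ = (V * (Zᴴ * (Uᴴ * (V * (Matrix.diagonal (fun i => (b i : ℂ)) * Vᴴ))))).trace := by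
          rw [hB.eq]; simp [Matrix.conjTranspose_mul, Matrix.mul_assoc]
      _ = _ := by
          rw [Matrix.trace_mul_comm, hW]; simp only [Matrix.mul_assoc, hV, Matrix.mul_one]
  have e3 : ((U * Z * Vᴴ)ᴴ * A * (U * Z * Vᴴ)).trace =
      (Zᴴ * (Matrix.diagonal (fun i => (a i : ℂ)) * Z)).trace := by
    calc _ = (V * (Zᴴ * (Matrix.diagonal (fun i => (a i : ℂ)) * (Z * Vᴴ)))).trace := by
          rw [hA.eq]; simp [Matrix.conjTranspose_mul, Matrix.mul_assoc, hU']
      _ = _ := by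
          rw [Matrix.trace_mul_comm]; simp only [Matrix.mul_assoc, hV, Matrix.mul_one]
  have e4 : ((U * Z * Vᴴ)ᴴ * (U * Z * Vᴴ) * B).trace =
      (Zᴴ * (Z * Matrix.diagonal (fun i => (b i : ℂ)))).trace := by
    calc _ = (V * (Zᴴ * (Z * (Matrix.diagonal (fun i => (b i : ℂ)) * Vᴴ)))).trace := by
          rw [hB.eq]; simp [Matrix.conjTranspose_mul, Matrix.mul_assoc, hU', hV']
      _ = _ := by
          rw [Matrix.trace_mul_comm]; simp only [Matrix.mul_assoc, hV, Matrix.mul_one]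
  have tr : ∀ M : Matrix n n ℂ, (Zᴴ * M).trace = ∑ i, ∑ j, star (Z i j) * M i j := fun M => by
    simp only [Matrix.trace, Matrix.diag_apply, Matrix.mul_apply, Matrix.conjTranspose_apply]
    exact Finset.sum_comm
  rw [chiSqDual, Matrix.mul_sub, Matrix.trace_sub, e1, e2, e3, e4]
  simp only [tr, ← Finset.sum_sub_distrib, Finset.mul_sum, Complex.re_sum, Matrix.diagonal_mul,
    Matrix.mul_diagonal]
  refine Finset.sum_congr rfl fun i _ => Finset.sum_congr rfl fun j _ => ?_
  simp [Complex.normSq_apply]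
  ring

theorem chiSqDual_le (s : ℝ) (hs : s ∈ Set.Ioo (0 : ℝ) 1) (Y : Matrix n n ℂ)
    {A U B V : Matrix n n ℂ} {a b : n → ℝ}
    (hA : IsSpectralDecomp A U a) (hB : IsSpectralDecomp B V b) (ha : ∀ i, 0 ≤ a i)
    (hb : ∀ i, 0 ≤ b i) : (chiSqDual s Y A B).re ≤ spectralChiSq s U a V b := by
  have hY : Y = U * (Uᴴ * Y * V) * Vᴴ := by
    have hU := mul_conjTranspose_self_of_mem_unitaryGroup hA.mem_unitaryGroup
    have hV := mul_conjTranspose_self_of_mem_unitaryGroup hB.mem_unitaryGroup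
    calc Y = (U * Uᴴ) * Y * (V * Vᴴ) := by rw [hU, hV, Matrix.one_mul, Matrix.mul_one]
      _ = _ := by simp only [Matrix.mul_assoc]
  rw [hY, chiSqDual_conj s _ hA hB]
  set Z := Uᴴ * Y * V
  refine Finset.sum_le_sum fun i _ => Finset.sum_le_sum fun j _ => ?_
  set z := Z i j
  set w := (Uᴴ * V) i j
  have hc : 0 ≤ s * a i + (1 - s) * b j :=
    add_nonneg (mul_nonneg hs.1.le (ha i)) (mul_nonneg (sub_nonneg.2 hs.2.le) (hb j))
  -- A vanishing denominator forces `a i = b j = 0`, as `s` is interior; otherwise complete the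
  -- square in the entry `z`.
  rcases hc.eq_or_lt with h | h
  · have h1 := mul_nonneg hs.1.le (ha i)
    have h2 := mul_nonneg (sub_nonneg.2 hs.2.le) (hb j)
    have h3 : a i = 0 := by
      have : s * a i = 0 := by linarith
      exact (mul_eq_zero.1 this).resolve_left hs.1.ne'
    have h4 : b j = 0 := by
      have : (1 - s) * b j = 0 := by linarith
      exact (mul_eq_zero.1 this).resolve_left (sub_pos.2 hs.2).ne'
    simp [h3, h4]
  · set c := s * a i + (1 - s) * b j
    set d := a i - b j
    rw [← mul_div_assoc, le_div_iff₀ h]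
    simp only [Complex.normSq_apply, RCLike.star_def, Complex.mul_re, Complex.conj_re,
      Complex.conj_im]
    nlinarith [sq_nonneg (c * z.re - d * w.re), sq_nonneg (c * z.im - d * w.im)]

theorem exists_chiSqDual_eq (s : ℝ) (hs : s ∈ Set.Ioo (0 : ℝ) 1)
    {A U B V : Matrix n n ℂ} {a b : n → ℝ}
    (hA : IsSpectralDecomp A U a) (hB : IsSpectralDecomp B V b) (ha : ∀ i, 0 ≤ a i)
    (hb : ∀ i, 0 ≤ b i) : ∃ Y, (chiSqDual s Y A B).re = spectralChiSq s U a V b := by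
  -- The entrywise maximiser `z = (a - b) w / c`. Where `c = 0`, division by zero makes both the
  -- entry and the target term zero.
  refine ⟨U * Matrix.of (fun i j =>
    (((a i - b j) / (s * a i + (1 - s) * b j) : ℝ) : ℂ) * (Uᴴ * V) i j) * Vᴴ, ?_⟩
  rw [chiSqDual_conj s _ hA hB]
  refine Finset.sum_congr rfl fun i _ => Finset.sum_congr rfl fun j _ => ?_
  set w := (Uᴴ * V) i j
  rw [Matrix.of_apply]
  have hc : 0 ≤ s * a i + (1 - s) * b j :=
    add_nonneg (mul_nonneg hs.1.le (ha i)) (mul_nonneg (sub_nonneg.2 hs.2.le) (hb j))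
  rcases hc.eq_or_lt with h | h
  · simp [← h]
  · set c := s * a i + (1 - s) * b j
    set d := a i - b j
    have e : (star (((d / c : ℝ) : ℂ) * w) * w).re = d / c * Complex.normSq w := by
      simp [Complex.normSq_apply]
      ring
    change 2 * (star (((d / c : ℝ) : ℂ) * w) * w).re * d -
      c * Complex.normSq (((d / c : ℝ) : ℂ) * w) = _
    rw [e, Complex.normSq_mul, Complex.normSq_ofReal]
    field_simp
    ring

/-- A supremum of linear functionals is subadditive: the maximiser `Y` for the sums is a competitor
for every summand. -/
theorem spectralChiSq_sum_le {ι : Type*} (t : Finset ι) (s : ℝ) (hs : s ∈ Set.Ioo (0 : ℝ) 1)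
    {A U B V : ι → Matrix n n ℂ} {a b : ι → n → ℝ} {U' V' : Matrix n n ℂ} {a' b' : n → ℝ}
    (hA : ∀ k ∈ t, IsSpectralDecomp (A k) (U k) (a k))
    (hB : ∀ k ∈ t, IsSpectralDecomp (B k) (V k) (b k))
    (ha : ∀ k ∈ t, ∀ i, 0 ≤ a k i) (hb : ∀ k ∈ t, ∀ i, 0 ≤ b k i)
    (hA' : IsSpectralDecomp (∑ k ∈ t, A k) U' a') (hB' : IsSpectralDecomp (∑ k ∈ t, B k) V' b')
    (ha' : ∀ i, 0 ≤ a' i) (hb' : ∀ i, 0 ≤ b' i) :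
    spectralChiSq s U' a' V' b' ≤ ∑ k ∈ t, spectralChiSq s (U k) (a k) (V k) (b k) := by
  obtain ⟨Y, hY⟩ := exists_chiSqDual_eq s hs hA' hB' ha' hb'
  rw [← hY, chiSqDual_sum, Complex.re_sum]
  exact Finset.sum_le_sum fun k hk =>
    chiSqDual_le s hs Y (hA k hk) (hB k hk) (ha k hk) (hb k hk)

/-- If `A ≤ B`, then the eigenvectors in the kernel of `B` are orthogonal to the eigenvectors of `A`
with nonzero eigenvalue. -/
theorem IsSpectralDecomp.eq_zero_of_posSemidef_sub {A U B V : Matrix n n ℂ} {a b : n → ℝ}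
    (hA : IsSpectralDecomp A U a) (hB : IsSpectralDecomp B V b) (ha : ∀ i, 0 ≤ a i)
    (hAB : (B - A).PosSemidef) {i j : n} (hW : (Uᴴ * V) i j ≠ 0) (hb : b j = 0) : a i = 0 := by
  have h := (hAB.conjTranspose_mul_mul_same V).diag_nonneg (i := j)
  have e : (Vᴴ * (B - A) * V) j j =
      ((-∑ i, Complex.normSq ((Uᴴ * V) i j) * a i : ℝ) : ℂ) := by
    rw [Matrix.mul_sub, Matrix.sub_mul, Matrix.sub_apply, hB.conj_eq, hA.diag_conj]
    simp [hb]
  rw [e] at h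
  have h' : 0 ≤ -∑ i, Complex.normSq ((Uᴴ * V) i j) * a i := by exact_mod_cast h
  have h1 : ∀ i ∈ Finset.univ, 0 ≤ Complex.normSq ((Uᴴ * V) i j) * a i :=
    fun i _ => mul_nonneg (Complex.normSq_nonneg _) (ha i)
  have h2 := (Finset.sum_eq_zero_iff_of_nonneg h1).1
    (le_antisymm (neg_nonneg.1 h') (Finset.sum_nonneg h1)) i (Finset.mem_univ i)
  exact (mul_eq_zero.1 h2).resolve_left fun h => hW (Complex.normSq_eq_zero.1 h)

/-- Integral representation of the relative entropy. -/
theorem integral_spectralChiSq {A U B V : Matrix n n ℂ} {a b : n → ℝ}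
    (hA : IsSpectralDecomp A U a) (hB : IsSpectralDecomp B V b) (ha : ∀ i, 0 ≤ a i)
    (hb : ∀ i, 0 ≤ b i) (hAB : (B - A).PosSemidef) :
    IntervalIntegrable (fun s => (1 - s) * spectralChiSq s U a V b) MeasureTheory.volume 0 1 ∧
    ∫ s in (0 : ℝ)..1, (1 - s) * spectralChiSq s U a V b = spectralRelEntropy U a V b := by
  have key : ∀ i j,
      IntervalIntegrable (fun s => Complex.normSq ((Uᴴ * V) i j) *
        ((1 - s) * ((a i - b j) ^ 2 / (s * a i + (1 - s) * b j)))) MeasureTheory.volume 0 1 ∧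
      ∫ s in (0 : ℝ)..1, Complex.normSq ((Uᴴ * V) i j) *
        ((1 - s) * ((a i - b j) ^ 2 / (s * a i + (1 - s) * b j))) =
      Complex.normSq ((Uᴴ * V) i j) * relEntropyKernel (a i) (b j) := fun i j => by
    by_cases hW : (Uᴴ * V) i j = 0
    · simp [hW]
    -- `A ≤ B` excludes the divergent case `b j = 0 < a i` wherever the weight is nonzero.
    · obtain ⟨h1, h2⟩ := integral_relEntropyKernel (ha i) (hb j)
        (hA.eq_zero_of_posSemidef_sub hB ha hAB hW)
      exact ⟨h1.const_mul _, by rw [intervalIntegral.integral_const_mul, h2]⟩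
  have e : (fun s => (1 - s) * spectralChiSq s U a V b) = fun s => ∑ i, ∑ j,
      Complex.normSq ((Uᴴ * V) i j) *
        ((1 - s) * ((a i - b j) ^ 2 / (s * a i + (1 - s) * b j))) := by
    funext s
    simp only [spectralChiSq, Finset.mul_sum]
    exact Finset.sum_congr rfl fun i _ => Finset.sum_congr rfl fun j _ => by ring
  have hint : ∀ i, IntervalIntegrable (fun s => ∑ j, Complex.normSq ((Uᴴ * V) i j) *
      ((1 - s) * ((a i - b j) ^ 2 / (s * a i + (1 - s) * b j)))) MeasureTheory.volume 0 1 :=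
    fun i => by
      simpa only [Finset.sum_fn] using IntervalIntegrable.sum Finset.univ fun j _ => (key i j).1
  refine ⟨?_, ?_⟩
  · rw [e]
    simpa only [Finset.sum_fn] using IntervalIntegrable.sum Finset.univ fun i _ => hint i
  · simp only [e]
    rw [intervalIntegral.integral_finsetSum fun i _ => hint i]
    refine Finset.sum_congr rfl fun i _ => ?_
    rw [intervalIntegral.integral_finsetSum fun j _ => (key i j).1]
    exact Finset.sum_congr rfl fun j _ => (key i j).2

/-- Joint convexity of the relative entropy, for positive semidefinite matrices `A k ≤ B k`. -/
theorem spectralRelEntropy_sum_le {ι : Type*} (t : Finset ι)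
    {A U B V : ι → Matrix n n ℂ} {a b : ι → n → ℝ} {U' V' : Matrix n n ℂ} {a' b' : n → ℝ}
    (hA : ∀ k ∈ t, IsSpectralDecomp (A k) (U k) (a k))
    (hB : ∀ k ∈ t, IsSpectralDecomp (B k) (V k) (b k))
    (ha : ∀ k ∈ t, ∀ i, 0 ≤ a k i) (hb : ∀ k ∈ t, ∀ i, 0 ≤ b k i)
    (hAB : ∀ k ∈ t, (B k - A k).PosSemidef)
    (hA' : IsSpectralDecomp (∑ k ∈ t, A k) U' a') (hB' : IsSpectralDecomp (∑ k ∈ t, B k) V' b')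
    (ha' : ∀ i, 0 ≤ a' i) (hb' : ∀ i, 0 ≤ b' i) :
    spectralRelEntropy U' a' V' b' ≤ ∑ k ∈ t, spectralRelEntropy (U k) (a k) (V k) (b k) := by
  have hAB' : (∑ k ∈ t, B k - ∑ k ∈ t, A k).PosSemidef := by
    rw [← Finset.sum_sub_distrib]
    exact Matrix.posSemidef_sum _ hAB
  have h' := integral_spectralChiSq hA' hB' ha' hb' hAB'
  have h := fun k hk => integral_spectralChiSq (hA k hk) (hB k hk) (ha k hk) (hb k hk) (hAB k hk)
  rw [← h'.2, ← Finset.sum_congr rfl fun k hk => (h k hk).2,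
    ← intervalIntegral.integral_finsetSum fun k hk => (h k hk).1]
  -- The variational bound is available only for `0 < s < 1`, which suffices under the integral.
  refine intervalIntegral.integral_mono_on_of_le_Ioo zero_le_one h'.1
    (by simpa only [Finset.sum_fn] using IntervalIntegrable.sum t fun k hk => (h k hk).1) fun s hs => ?_
  rw [← Finset.mul_sum]
  exact mul_le_mul_of_nonneg_left (spectralChiSq_sum_le t s hs hA hB ha hb hA' hB' ha' hb')
    (sub_nonneg.2 hs.2.le)

end JointConvexity

/-! ### Conditional entropy of separable states -/

section SeparableEntropy

variable {n n' : Type*} [Fintype n] [DecidableEq n] [Fintype n'] [DecidableEq n']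

theorem IsSpectralDecomp.sub {A B U : Matrix n n ℂ} {a b : n → ℝ}
    (hA : IsSpectralDecomp A U a) (hB : IsSpectralDecomp B U b) :
    IsSpectralDecomp (A - B) U fun i => a i - b i where
  mem_unitaryGroup := hA.mem_unitaryGroup
  eq := by
    rw [hA.eq, hB.eq, ← Matrix.sub_mul, ← Matrix.mul_sub, Matrix.diagonal_sub]
    simp

theorem IsSpectralDecomp.posSemidef {A U : Matrix n n ℂ} {a : n → ℝ}
    (h : IsSpectralDecomp A U a) (ha : ∀ i, 0 ≤ a i) : A.PosSemidef := by
  rw [h.eq]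
  refine Matrix.PosSemidef.mul_mul_conjTranspose_same (Matrix.PosSemidef.diagonal fun i => ?_) U
  exact Complex.zero_le_real.2 (ha i)

theorem IsSpectralDecomp.sum_eq_one {A U : Matrix n n ℂ} {a : n → ℝ}
    (h : IsSpectralDecomp A U a) (hA : A.trace = 1) : ∑ i, a i = 1 := by
  have h' := h.trace_eq_sum.symm.trans hA
  exact_mod_cast h'

theorem spectralRelEntropy_self {U : Matrix n n ℂ} (hU : U ∈ Matrix.unitaryGroup n ℂ)
    (a b : n → ℝ) : spectralRelEntropy U a U b = ∑ i, relEntropyKernel (a i) (b i) := by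
  simp only [spectralRelEntropy, conjTranspose_mul_self_of_mem_unitaryGroup hU]
  refine Finset.sum_congr rfl fun i _ => ?_
  rw [Finset.sum_eq_single i (fun j _ hj => by simp [Matrix.one_apply_ne hj.symm]) (by simp)]
  simp

/-- Recovers the trace form `-S(A) - Tr A log B - Tr A + Tr B` from the double sum, because the
weights have unit row and column sums. -/
theorem spectralRelEntropy_eq {A U V : Matrix n n ℂ} {a : n → ℝ} (hA : IsSpectralDecomp A U a)
    (hV : V ∈ Matrix.unitaryGroup n ℂ) (b : n → ℝ) :
    spectralRelEntropy U a V b = -vonNeumannEntropy A -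
      ∑ j, ((Vᴴ * A * V) j j).re * Real.log (b j) - ∑ i, a i + ∑ j, b j := by
  have hW := conjTranspose_mul_mem_unitaryGroup hA.mem_unitaryGroup hV
  have e : ∀ i j, Complex.normSq ((Uᴴ * V) i j) * relEntropyKernel (a i) (b j) =
      Complex.normSq ((Uᴴ * V) i j) * (-Real.negMulLog (a i) - a i) -
        Complex.normSq ((Uᴴ * V) i j) * a i * Real.log (b j) +
        Complex.normSq ((Uᴴ * V) i j) * b j := fun i j => by
    rw [relEntropyKernel, Real.negMulLog]
    ring
  simp only [spectralRelEntropy, e, Finset.sum_add_distrib, Finset.sum_sub_distrib,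
    hA.diag_conj, Complex.ofReal_re, hA.entropy_eq]
  rw [Finset.sum_comm (f := fun i j => Complex.normSq ((Uᴴ * V) i j) * a i * Real.log (b j)),
    Finset.sum_comm (f := fun i j => Complex.normSq ((Uᴴ * V) i j) * b j)]
  simp only [← Finset.sum_mul, sum_normSq_row hW, sum_normSq_col hW, one_mul,
    Finset.sum_sub_distrib, Finset.sum_neg_distrib]
  ring

theorem relEntropyKernel_mul_left (x s : ℝ) :
    relEntropyKernel (x * s) x = -(x * Real.negMulLog s) - x * s + x := by
  rcases eq_or_ne x 0 with rfl | hx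
  · simp [relEntropyKernel]
  rcases eq_or_ne s 0 with rfl | hs
  · simp [relEntropyKernel]
  rw [relEntropyKernel, Real.log_mul hx hs, Real.negMulLog]
  ring

/-- The conditional entropy of a separable state `∑ tₖ Rₖ ⊗ σₖ` is at least `∑ tₖ S(σₖ)`. -/
theorem vonNeumannEntropy_separable_ge {ι : Type*} [Fintype ι] {t : ι → ℝ}
    {R : ι → Matrix n n ℂ} {σ : ι → Matrix n' n' ℂ} (ht : ∀ k, 0 ≤ t k) (hs : ∑ k, t k = 1)
    (hR : ∀ k, IsDensityMatrix (R k)) (hσ : ∀ k, IsDensityMatrix (σ k)) :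
    vonNeumannEntropy (∑ k, (t k : ℂ) • R k) + ∑ k, t k * vonNeumannEntropy (σ k) ≤
      vonNeumannEntropy (∑ k, (t k : ℂ) • (R k ⊗ₖ σ k)) := by
  choose U r hU hr using fun k => exists_isSpectralDecomp (hR k).posSemidef
  choose V s hV hs0 using fun k => exists_isSpectralDecomp (hσ k).posSemidef
  have hrs : ∀ k, ∑ i, r k i = 1 := fun k => (hU k).sum_eq_one (hR k).trace_eq_one
  have hss : ∀ k, ∑ i, s k i = 1 := fun k => (hV k).sum_eq_one (hσ k).trace_eq_one
  have hs1 : ∀ k i, s k i ≤ 1 := fun k i =>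
    hss k ▸ Finset.single_le_sum (fun j _ => hs0 k j) (Finset.mem_univ i)
  set A : ι → Matrix (n × n') (n × n') ℂ := fun k => (t k : ℂ) • (R k ⊗ₖ σ k) with hAdef
  set B : ι → Matrix (n × n') (n × n') ℂ := fun k => (t k : ℂ) • (R k ⊗ₖ 1) with hBdef
  have hA := fun k => ((hU k).kronecker (hV k)).smul (t k)
  -- The identity is diagonalised by `V k` so that `A k` and `B k` share an eigenbasis and their
  -- relative entropy is classical.
  have hB := fun k => ((hU k).kronecker (isSpectralDecomp_one (hV k).mem_unitaryGroup)).smul (t k)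
  -- A density matrix satisfies `σ ≤ 1`.
  have hBA : ∀ k, (B k - A k).PosSemidef := fun k =>
    ((hB k).sub (hA k)).posSemidef fun p => by
      rw [← mul_sub, ← mul_sub]
      exact mul_nonneg (ht k) (mul_nonneg (hr k _) (sub_nonneg.2 (hs1 k _)))
  have hApos : (∑ k, A k).PosSemidef := Matrix.posSemidef_sum _ fun k _ =>
    (hA k).posSemidef fun p => mul_nonneg (ht k) (mul_nonneg (hr k _) (hs0 k _))
  have hRpos : (∑ k, (t k : ℂ) • R k).PosSemidef := Matrix.posSemidef_sum _ fun k _ =>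
    ((hU k).smul (t k)).posSemidef fun p => mul_nonneg (ht k) (hr k _)
  have hRtr : (∑ k, (t k : ℂ) • R k).trace = 1 := by
    simp only [Matrix.trace_sum, Matrix.trace_smul, (hR _).trace_eq_one, smul_eq_mul, mul_one]
    exact_mod_cast hs
  have hsnd : traceSnd (∑ k, A k) = ∑ k, (t k : ℂ) • R k := by
    simp only [hAdef, traceSnd_sum, traceSnd_smul, traceSnd_kronecker, (hσ _).trace_eq_one,
      one_smul]
  obtain ⟨UA, a, hA', ha'⟩ := exists_isSpectralDecomp hApos
  obtain ⟨UR, r', hR', hr'⟩ := exists_isSpectralDecomp hRpos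
  have hone := isSpectralDecomp_one (one_mem (Matrix.unitaryGroup n' ℂ))
  have hBsum : ∑ k, B k = (∑ k, (t k : ℂ) • R k) ⊗ₖ (1 : Matrix n' n' ℂ) := by
    ext p q
    simp [hBdef, Matrix.sum_apply, Finset.sum_mul, mul_assoc]
  have hB' := hR'.kronecker hone
  rw [← hBsum] at hB'
  have key := spectralRelEntropy_sum_le Finset.univ (fun k _ => hA k) (fun k _ => hB k)
    (fun k _ p => mul_nonneg (ht k) (mul_nonneg (hr k _) (hs0 k _)))
    (fun k _ p => mul_nonneg (ht k) (mul_nonneg (hr k _) zero_le_one)) (fun k _ => hBA k)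
    hA' hB' ha' fun p => mul_nonneg (hr' _) zero_le_one
  have hright : ∀ k, spectralRelEntropy (U k ⊗ₖ V k) (fun p => t k * (r k p.1 * s k p.2))
      (U k ⊗ₖ V k) (fun p => t k * (r k p.1 * 1)) =
      -(t k * vonNeumannEntropy (σ k)) - t k + t k * Fintype.card n' := fun k => by
    rw [spectralRelEntropy_self (hA k).mem_unitaryGroup, (hV k).entropy_eq]
    simp only [mul_one, ← mul_assoc, relEntropyKernel_mul_left, Fintype.sum_prod_type,
      Finset.sum_add_distrib, Finset.sum_sub_distrib, Finset.sum_neg_distrib, ← Finset.mul_sum,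
      ← Finset.sum_mul, hss, hrs, Finset.sum_const, Finset.card_univ, nsmul_eq_mul]
  have hleft : spectralRelEntropy UA a (UR ⊗ₖ 1) (fun p => r' p.1 * 1) =
      -vonNeumannEntropy (∑ k, A k) + vonNeumannEntropy (∑ k, (t k : ℂ) • R k) - 1 +
        Fintype.card n' := by
    have hr1 : ∑ i, r' i = 1 := hR'.sum_eq_one hRtr
    have ha1 : ∑ i, a i = 1 := hA'.sum_eq_one (by rw [← trace_traceSnd, hsnd, hRtr])
    -- The logarithm depends only on the first index, so only the first marginal `∑ t_k R_k` enters,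
    -- and it is diagonal in the basis `UR`.
    have hd : ∑ p : n × n', (((UR ⊗ₖ (1 : Matrix n' n' ℂ))ᴴ * (∑ k, A k) * (UR ⊗ₖ (1 : Matrix n' n' ℂ)) :
        Matrix (n × n') (n × n') ℂ) p p).re *
        Real.log (r' p.1 * 1) = -∑ i, Real.negMulLog (r' i) := by
      rw [Fintype.sum_prod_type, ← Finset.sum_neg_distrib]
      refine Finset.sum_congr rfl fun i _ => ?_
      have h := congrFun (congrFun (traceSnd_conj_kronecker (∑ k, A k) UR
        (one_mem (Matrix.unitaryGroup n' ℂ))) i) i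
      rw [hsnd, hR'.conj_eq, Matrix.diagonal_apply_eq] at h
      have h' := congrArg Complex.re h
      rw [Complex.ofReal_re, traceSnd, Matrix.of_apply, Complex.re_sum] at h'
      refine (Finset.sum_mul _ _ (Real.log (r' i * 1))).symm.trans ?_
      rw [h', mul_one, Real.negMulLog]
      ring
    rw [spectralRelEntropy_eq hA' hB'.mem_unitaryGroup, hd, ha1, hR'.entropy_eq]
    simp only [mul_one, Fintype.sum_prod_type, Finset.sum_const, Finset.card_univ, nsmul_eq_mul,
      ← Finset.mul_sum, hr1]
    ring
  rw [hleft, Finset.sum_congr rfl fun k _ => hright k] at key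
  simp only [Finset.sum_add_distrib, Finset.sum_sub_distrib, Finset.sum_neg_distrib,
    ← Finset.sum_mul, hs] at key
  linarith

end SeparableEntropy

/-! ### Measurement of the first tensor factor -/

section LocalMeasurement

variable {m m' : Type*} [Fintype m] [Fintype m'] [DecidableEq m']

/-- The left side is the unnormalised state of the second factor after outcome `X` on the first. As
a combination of blocks of `ρ` it can be compared with `tensorMap`. -/
theorem traceFst_kronecker_one_mul (X : Matrix m m ℂ) (ρ : Matrix (m × m') (m × m') ℂ) :
    traceFst ((X ⊗ₖ (1 : Matrix m' m' ℂ)) * ρ) =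
      ∑ i, ∑ j, X i j • Matrix.of fun k l => ρ (j, k) (i, l) := by
  ext k l
  simp [traceFst, Matrix.mul_apply, Fintype.sum_prod_type, Matrix.sum_apply, Matrix.one_apply]

theorem traceFst_kronecker_one_mul_comm (X : Matrix m m ℂ) (ρ : Matrix (m × m') (m × m') ℂ) :
    traceFst ((X ⊗ₖ (1 : Matrix m' m' ℂ)) * ρ) = traceFst (ρ * (X ⊗ₖ (1 : Matrix m' m' ℂ))) := by
  ext k l
  simp only [traceFst, Matrix.of_apply, Matrix.mul_apply, Fintype.sum_prod_type,
    Matrix.kroneckerMap_apply, Matrix.one_apply, mul_ite, mul_one, mul_zero, ite_mul, zero_mul,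
    Finset.sum_ite_eq, Finset.sum_ite_eq', Finset.mem_univ, if_true]
  rw [Finset.sum_comm]
  simp only [mul_comm]

theorem trace_traceFst_kronecker_one_mul (X : Matrix m m ℂ) (ρ : Matrix (m × m') (m × m') ℂ) :
    (traceFst ((X ⊗ₖ (1 : Matrix m' m' ℂ)) * ρ)).trace = (X * traceSnd ρ).trace := by
  rw [traceFst_kronecker_one_mul]
  simp only [Matrix.trace_sum, Matrix.trace_smul]
  simp [Matrix.trace, traceSnd, Matrix.mul_apply]

/-- With `X = Bᴴ B`, cyclicity of the partial trace in the traced factor turns the product into a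
congruence of `ρ`. -/
theorem posSemidef_traceFst_kronecker_one_mul [DecidableEq m] {X : Matrix m m ℂ}
    {ρ : Matrix (m × m') (m × m') ℂ} (hX : X.PosSemidef) (hρ : ρ.PosSemidef) :
    (traceFst ((X ⊗ₖ (1 : Matrix m' m' ℂ)) * ρ)).PosSemidef := by
  obtain ⟨B, rfl⟩ : ∃ B, X = Bᴴ * B := by
    open scoped MatrixOrder in
    exact CStarAlgebra.nonneg_iff_eq_star_mul_self.mp hX.nonneg
  have e : traceFst (((Bᴴ * B) ⊗ₖ (1 : Matrix m' m' ℂ)) * ρ) =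
      traceFst ((B ⊗ₖ (1 : Matrix m' m' ℂ)) * ρ * (B ⊗ₖ (1 : Matrix m' m' ℂ))ᴴ) := by
    rw [Matrix.conjTranspose_kronecker, Matrix.conjTranspose_one, ← traceFst_kronecker_one_mul_comm,
      ← Matrix.mul_assoc, ← Matrix.mul_kronecker_mul, Matrix.one_mul]
  rw [e, traceFst_eq_sum_submatrix]
  exact Matrix.posSemidef_sum _ fun i _ => (hρ.mul_mul_conjTranspose_same _).submatrix _

/-- A measure-and-prepare map on the first tensor factor. -/
theorem tensorMap_measure_prepare {n n' : Type*} {Φ : Matrix m m ℂ →ₗ[ℂ] Matrix n n ℂ} {K : ℕ}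
    {R : Fin K → Matrix n n ℂ} {X : Fin K → Matrix m m ℂ}
    (hΦ : ∀ ρ, Φ ρ = ∑ k, (X k * ρ).trace • R k) (Ω : Matrix m' m' ℂ →ₗ[ℂ] Matrix n' n' ℂ)
    (ρ : Matrix (m × m') (m × m') ℂ) :
    tensorMap Φ Ω ρ = ∑ k, R k ⊗ₖ Ω (traceFst ((X k ⊗ₖ (1 : Matrix m' m' ℂ)) * ρ)) := by
  ext p q
  change Φ (Matrix.of fun i j => Ω (Matrix.of fun k l => ρ (i, k) (j, l)) p.2 q.2) p.1 q.1 = _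
  rw [hΦ, Matrix.sum_apply, Matrix.sum_apply]
  refine Finset.sum_congr rfl fun k _ => ?_
  rw [Matrix.smul_apply, smul_eq_mul, mul_comm, Matrix.kroneckerMap_apply,
    traceFst_kronecker_one_mul]
  simp [Matrix.trace, Matrix.mul_apply, Matrix.sum_apply, -Matrix.smul_of]

end LocalMeasurement

/-! ### Additivity of the Holevo capacity -/

section Holevo

variable {m n m' n' : Type*} [Fintype m] [Fintype n] [DecidableEq n] [Fintype m'] [Fintype n']
  [DecidableEq n']

/-- Allows ensembles over any finite type, in particular those indexed by pairs. -/
theorem mem_holevoQuantities {Ω : Matrix m m ℂ →ₗ[ℂ] Matrix n n ℂ} {ι : Type*} [Fintype ι]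
    {p : ι → ℝ} {ρ : ι → Matrix m m ℂ} (hp : ∀ k, 0 ≤ p k) (hs : ∑ k, p k = 1)
    (hρ : ∀ k, IsDensityMatrix (ρ k)) :
    vonNeumannEntropy (Ω (∑ k, (p k : ℂ) • ρ k)) - ∑ k, p k * vonNeumannEntropy (Ω (ρ k)) ∈
      holevoQuantities Ω := by
  let e := (Fintype.equivFin ι).symm
  refine ⟨Fintype.card ι, p ∘ e, ρ ∘ e, fun k => hp _, ?_, fun k => hρ _, ?_⟩
  · rw [← hs]
    exact Equiv.sum_comp e p
  · rw [← Equiv.sum_comp e, ← Equiv.sum_comp e (fun k => p k * vonNeumannEntropy (Ω (ρ k)))]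
    rfl

theorem IsDensityMatrix.kronecker {ρ : Matrix m m ℂ} {σ : Matrix m' m' ℂ}
    (hρ : IsDensityMatrix ρ) (hσ : IsDensityMatrix σ) : IsDensityMatrix (ρ ⊗ₖ σ) where
  posSemidef := hρ.posSemidef.kronecker hσ.posSemidef
  trace_eq_one := by rw [Matrix.trace_kronecker, hρ.trace_eq_one, hσ.trace_eq_one, one_mul]

/-- Product ensembles show that the Holevo capacity is superadditive. -/
theorem add_mem_holevoQuantities_tensorMap {Φ : Matrix m m ℂ →ₗ[ℂ] Matrix n n ℂ}
    {Ω : Matrix m' m' ℂ →ₗ[ℂ] Matrix n' n' ℂ} (hΦ : IsChannel Φ) (hΩ : IsChannel Ω) {x y : ℝ}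
    (hx : x ∈ holevoQuantities Φ) (hy : y ∈ holevoQuantities Ω) :
    x + y ∈ holevoQuantities (tensorMap Φ Ω) := by
  obtain ⟨K, p, ρ, hp, hps, hρ, rfl⟩ := hx
  obtain ⟨L, q, σ, hq, hqs, hσ, rfl⟩ := hy
  have h := mem_holevoQuantities (Ω := tensorMap Φ Ω) (p := fun k : Fin K × Fin L => p k.1 * q k.2)
    (ρ := fun k => ρ k.1 ⊗ₖ σ k.2) (fun k => mul_nonneg (hp _) (hq _))
    (by rw [Fintype.sum_prod_type, ← Finset.sum_mul_sum, hps, hqs, one_mul])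
    fun k => (hρ _).kronecker (hσ _)
  convert h using 1
  have e : ∑ k : Fin K × Fin L, ((p k.1 * q k.2 : ℝ) : ℂ) • (ρ k.1 ⊗ₖ σ k.2) =
      (∑ k, (p k : ℂ) • ρ k) ⊗ₖ (∑ l, (q l : ℂ) • σ l) := by
    ext a b
    simp only [Matrix.sum_apply, Matrix.smul_apply, Matrix.kroneckerMap_apply,
      Fintype.sum_prod_type, Finset.sum_mul_sum, smul_eq_mul, Complex.ofReal_mul]
    exact Finset.sum_congr rfl fun i _ => Finset.sum_congr rfl fun j _ => by ring
  rw [e, tensorMap_kronecker, vonNeumannEntropy_kronecker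
    (hΦ.map_isDensityMatrix (.sum_smul hp hps hρ)) (hΩ.map_isDensityMatrix (.sum_smul hq hqs hσ))]
  have e' : ∀ k : Fin K × Fin L, p k.1 * q k.2 *
      vonNeumannEntropy (tensorMap Φ Ω (ρ k.1 ⊗ₖ σ k.2)) =
      (p k.1 * vonNeumannEntropy (Φ (ρ k.1))) * q k.2 +
        p k.1 * (q k.2 * vonNeumannEntropy (Ω (σ k.2))) := fun k => by
    rw [tensorMap_kronecker, vonNeumannEntropy_kronecker (hΦ.map_isDensityMatrix (hρ _))
      (hΩ.map_isDensityMatrix (hσ _))]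
    ring
  simp only [e', Finset.sum_add_distrib, Fintype.sum_prod_type, ← Finset.sum_mul_sum, hps, hqs,
    one_mul, mul_one]
  ring

theorem exists_isDensityMatrix (m : Type*) [Fintype m] [DecidableEq m] [Nonempty m] :
    ∃ ρ : Matrix m m ℂ, IsDensityMatrix ρ := by
  obtain ⟨i⟩ := ‹Nonempty m›
  exact ⟨Matrix.diagonal (Pi.single i 1),
    Matrix.PosSemidef.diagonal (Pi.single_nonneg.2 zero_le_one), by simp [Matrix.trace]⟩

/-- A positive semidefinite matrix is a multiple of a density matrix. -/
theorem exists_eq_smul_isDensityMatrix [DecidableEq m] [Nonempty m] {A : Matrix m m ℂ}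
    (hA : A.PosSemidef) : ∃ ρ, IsDensityMatrix ρ ∧ A = A.trace • ρ := by
  by_cases h : A.trace = 0
  -- Trace zero forces `A = 0`, so any state will do; this covers outcomes of probability zero.
  · obtain ⟨ρ, hρ⟩ := exists_isDensityMatrix m
    exact ⟨ρ, hρ, by rw [h, zero_smul]; exact hA.trace_eq_zero_iff.1 h⟩
  · refine ⟨A.trace⁻¹ • A, ⟨hA.smul (inv_nonneg.2 hA.trace_nonneg), ?_⟩, ?_⟩
    · rw [Matrix.trace_smul, smul_eq_mul, inv_mul_cancel₀ h]
    · rw [smul_smul, mul_inv_cancel₀ h, one_smul]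

/-- Every Holevo quantity of `Φ ⊗ Ω` with `Φ` entanglement breaking is bounded by the sum of a
Holevo quantity of `Φ` and a Holevo quantity of `Ω`. -/
theorem exists_le_add_of_mem_holevoQuantities_tensorMap [DecidableEq m]
    [DecidableEq m'] [Nonempty m']
    {Φ : Matrix m m ℂ →ₗ[ℂ] Matrix n n ℂ} (hΦ : IsEntanglementBreaking Φ)
    {Ω : Matrix m' m' ℂ →ₗ[ℂ] Matrix n' n' ℂ} (hΩ : IsChannel Ω) {x : ℝ}
    (hx : x ∈ holevoQuantities (tensorMap Φ Ω)) :
    ∃ y ∈ holevoQuantities Φ, ∃ z ∈ holevoQuantities Ω, x ≤ y + z := by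
  have hΦc := hΦ.isChannel
  obtain ⟨K, R, X, hR, hX, hXs, hΦ⟩ := hΦ
  obtain ⟨N, p, ρ, hp, hps, hρ, rfl⟩ := hx
  have hpos := fun i k => posSemidef_traceFst_kronecker_one_mul (hX k) (hρ i).posSemidef
  choose τ hτ hτe using fun i k => exists_eq_smul_isDensityMatrix (hpos i k)
  -- `t i k` is the probability of outcome `k` on `ρ i`, and `τ i k` the resulting state of the
  -- second factor.
  set t : Fin N → Fin K → ℝ := fun i k => (X k * traceSnd (ρ i)).trace.re with htdef
  have htr : ∀ i k, (X k * traceSnd (ρ i)).trace = (t i k : ℂ) := fun i k => by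
    have h := (hpos i k).trace_nonneg
    rw [trace_traceFst_kronecker_one_mul] at h
    exact Complex.eq_re_of_ofReal_le (r := 0) (by simpa using h)
  have ht : ∀ i k, 0 ≤ t i k := fun i k => by
    have h := (hpos i k).trace_nonneg
    rw [trace_traceFst_kronecker_one_mul, htr] at h
    exact_mod_cast h
  have hts : ∀ i, ∑ k, t i k = 1 := fun i => by
    have h : ((∑ k, t i k : ℝ) : ℂ) = 1 := by
      push_cast
      rw [← Finset.sum_congr rfl fun k _ => htr i k, ← Matrix.trace_sum, ← Matrix.sum_mul, hXs,
        Matrix.one_mul, (hρ i).traceSnd.trace_eq_one]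
    exact_mod_cast h
  have hΦα : ∀ i, Φ (traceSnd (ρ i)) = ∑ k, (t i k : ℂ) • R k := fun i => by
    simp only [hΦ, htr]
  have hout : ∀ i, tensorMap Φ Ω (ρ i) = ∑ k, (t i k : ℂ) • (R k ⊗ₖ Ω (τ i k)) := fun i => by
    rw [tensorMap_measure_prepare hΦ]
    refine Finset.sum_congr rfl fun k _ => ?_
    rw [hτe i k, trace_traceFst_kronecker_one_mul, htr, map_smul, Matrix.kronecker_smul]
  have hΩτ := fun i k => hΩ.map_isDensityMatrix (hτ i k)
  -- `Φ` receives the reduced states with weights `p i`; `Ω` receives the refined ensemble of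
  -- conditional states `τ i k` with weights `p i * t i k`.
  refine ⟨_, mem_holevoQuantities hp hps fun i => (hρ i).traceSnd, _,
    mem_holevoQuantities (p := fun x : Fin N × Fin K => p x.1 * t x.1 x.2)
      (ρ := fun x => τ x.1 x.2) (fun x => mul_nonneg (hp _) (ht _ _)) ?_ fun x => hτ _ _, ?_⟩
  · simp only [Fintype.sum_prod_type, ← Finset.mul_sum, hts, mul_one, hps]
  have h1 := vonNeumannEntropy_le_traceSnd_add_traceFst
    ((hΦc.tensorMap hΩ).map_isDensityMatrix (.sum_smul hp hps hρ))
  have e1 : traceSnd (tensorMap Φ Ω (∑ i, (p i : ℂ) • ρ i)) =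
      Φ (∑ i, (p i : ℂ) • traceSnd (ρ i)) := by
    simp only [map_sum, map_smul, hout, hΦα, traceSnd_sum, traceSnd_smul, traceSnd_kronecker,
      (hΩτ _ _).trace_eq_one, one_smul]
  have e2 : traceFst (tensorMap Φ Ω (∑ i, (p i : ℂ) • ρ i)) =
      Ω (∑ x : Fin N × Fin K, ((p x.1 * t x.1 x.2 : ℝ) : ℂ) • τ x.1 x.2) := by
    simp only [map_sum, map_smul, hout, traceFst_sum, traceFst_smul, traceFst_kronecker,
      (hR _).trace_eq_one, one_smul, Fintype.sum_prod_type, Finset.smul_sum, smul_smul,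
      Complex.ofReal_mul]
  have h2 : ∑ i, p i * (vonNeumannEntropy (Φ (traceSnd (ρ i))) +
      ∑ k, t i k * vonNeumannEntropy (Ω (τ i k))) ≤
      ∑ i, p i * vonNeumannEntropy (tensorMap Φ Ω (ρ i)) :=
    Finset.sum_le_sum fun i _ => mul_le_mul_of_nonneg_left (by
      rw [hΦα, hout]
      exact vonNeumannEntropy_separable_ge (ht i) (hts i) hR (hΩτ i)) (hp i)
  -- The terms `p i * S(Φ(traceSnd (ρ i)))` and `p i * t i k * S(Ω(τ i k))` are exactly those
  -- subtracted in the two Holevo quantities.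
  rw [e1, e2] at h1
  simp only [mul_add, Finset.sum_add_distrib, Finset.mul_sum, ← mul_assoc] at h2
  rw [Fintype.sum_prod_type (fun x : Fin N × Fin K =>
    p x.1 * t x.1 x.2 * vonNeumannEntropy (Ω (τ x.1 x.2)))]
  linarith

end Holevo

end Quantum

end

theorem mainTheorem5 {m n m' n' : Type*}
    [Fintype m] [DecidableEq m] [Nonempty m] [Fintype n] [DecidableEq n]
    [Fintype m'] [DecidableEq m'] [Nonempty m'] [Fintype n'] [DecidableEq n']
    (Φ : Matrix m m ℂ →ₗ[ℂ] Matrix n n ℂ) (hΦ : Quantum.IsEntanglementBreaking Φ)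
    (Ω : Matrix m' m' ℂ →ₗ[ℂ] Matrix n' n' ℂ) (hΩ : Quantum.IsChannel Ω) :
    Quantum.holevoCapacity (Quantum.tensorMap Φ Ω) =
      Quantum.holevoCapacity Φ + Quantum.holevoCapacity Ω := by
  have hΦc := hΦ.isChannel
  have hbΦ := Quantum.holevoQuantities_bddAbove hΦc
  have hbΩ := Quantum.holevoQuantities_bddAbove hΩ
  apply le_antisymm
  · refine csSup_le (Quantum.holevoQuantities_nonempty _) fun x hx => ?_
    obtain ⟨y, hy, z, hz, h⟩ :=
      Quantum.exists_le_add_of_mem_holevoQuantities_tensorMap hΦ hΩ hx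
    exact h.trans (add_le_add (le_csSup hbΦ hy) (le_csSup hbΩ hz))
  -- The two suprema are taken one at a time, the other summand being moved across the inequality.
  · rw [← le_sub_iff_add_le]
    refine csSup_le (Quantum.holevoQuantities_nonempty _) fun y hy => ?_
    rw [le_sub_comm]
    refine csSup_le (Quantum.holevoQuantities_nonempty _) fun z hz => ?_
    rw [le_sub_iff_add_le, add_comm]
    exact le_csSup (Quantum.holevoQuantities_bddAbove (hΦc.tensorMap hΩ))
      (Quantum.add_mem_holevoQuantities_tensorMap hΦc hΩ hy hz)
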